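/- Let $k$ be a field, let $\Gamma$ be a finite group and let $G$ be a finite $\Gamma$-group, i.e. a finite group on which $\Gamma$ acts by group automorphisms $g\mapsto{}^{\sigma}g$. Let $x\in G$, let $\Gamma_x$ be the stabilizer of $x$ in $\Gamma$, and let $C_G(x)$ be the centralizer of $x$ in $G$; it is a $\Gamma_x$-group. Extend the action of $\Gamma$ linearly to the group algebra $kG$. For $n\ge 0$ let $C^n_{\Gamma_x}(C_G(x),k)$ be the space of maps $\psi:C_G(x)^n\to k$ with $\psi({}^{\sigma}h_1,\dots,{}^{\sigma}h_n)=\psi(h_1,\dots,h_n)$ for all $\sigma\in\Gamma_x$, with the usual inhomogeneous differential for trivial coefficients $$\partial^n\psi(h_1,\dots,h_{n+1})=\psi(h_2,\dots,h_{n+1})+\sum_{j=1}^n(-1)^j\psi(\dots,h_jh_{j+1},\dots)+(-1)^{n+1}\psi(h_1,\dots,h_n),$$ and let $\mathrm H^n_{\Gamma_x}(C_G(x),k)=\operatorname{Ker}\partial^n/\operatorname{Im}\partial^{n-1}$ be its cohomology. Let $C^n_{\Gamma_x}(kG,kG)$ be the space of $k$-linear maps $\varphi:(kG)^{\otimes n}\to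 kG$ with $\varphi({}^{\sigma}a_1\otimes\dots\otimes{}^{\sigma}a_n)={}^{\sigma}\varphi(a_1\otimes\dots\otimes a_n)$ for all $\sigma\in\Gamma_x$, with the Hochschild differential $$\delta^n\varphi(a_1\otimes\dots\otimes a_{n+1})=a_1\varphi(a_2\otimes\dots\otimes a_{n+1})+\sum_{j=1}^n(-1)^j\varphi(\dots\otimes a_ja_{j+1}\otimes\dots)+(-1)^{n+1}\varphi(a_1\otimes\dots\otimes a_n)a_{n+1},$$ and let $\mathrm{HH}^n_{\Gamma_x}(kG)=\operatorname{Ker}\delta^n/\operatorname{Im}\delta^{n-1}$ be its cohomology. (For $n=0$ the images are $0$.) Let $\gamma_x\subseteq G$ be a system of representatives with $1\in\gamma_x$ and $G=\bigsqcup_{\gamma\in\gamma_x}C_G(x)\gamma$, and suppose that $\gamma_x$ is $\Gamma_x$-stable, i.e. ${}^{\sigma}\gamma_x=\gamma_x$ for all $\sigma\in\Gamma_x$. For $\gamma\in\gamma_x$ and $g_1,\dots,g_n\in G$ let $h_{\gamma,i}\in C_G(x)$ and $\gamma^i\in\gamma_x$ be determined by $\gamma^0=\gamma$ and $\gamma^{i-1}g_i=h_{\gamma,i}\gamma^i$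 for $1\le i\le n$. Define $$\nu^n(\psi)(g_1\otimes\dots\otimes g_n)=\sum_{\gamma\in\gamma_x}\psi(h_{\gamma,1},\dots,h_{\gamma,n})\,\gamma^{-1}x\gamma\,g_1\cdots g_n$$ for $\psi:C_G(x)^n\to k$ and $g_1,\dots,g_n\in G$, extended linearly to $(kG)^{\otimes n}$. For $\varphi:(kG)^{\otimes n}\to kG$ and $h_1,\dots,h_n\in C_G(x)$ let $\pi^n(\varphi)(h_1,\dots,h_n)$ be the coefficient of $x$ in $\varphi(h_1\otimes\dots\otimes h_n)h_n^{-1}\cdots h_1^{-1}$. Then $\nu^*$ and $\pi^*$ restrict to cochain maps between the complexes $C^*_{\Gamma_x}(C_G(x),k)$ and $C^*_{\Gamma_x}(kG,kG)$, and for every $n\ge 0$ the $k$-linear map $$\nu^n_{\Gamma_x,G}:\mathrm H^n_{\Gamma_x}(C_G(x),k)\to\mathrm{HH}^n_{\Gamma_x}(kG)$$ induced by $\nu^n$ is injective, with left inverse the $k$-linear map $\pi^n_{\Gamma_x,G}:\mathrm{HH}^n_{\Gamma_x}(kG)\to\mathrm H^n_{\Gamma_x}(C_G(x),k)$ induced by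 $\pi^n$. -/

import Mathlib

noncomputable section

namespace EquivCoh

/-! ### Equivariant cohomology of groups -/

section GroupCohomology

/-- A `Γ`-equivariant `kG`-module structure on the `k`-module `N`, for a `Γ`-group `G`: linear actions
of `G` and of `Γ` with `σ (g m) = (σ g) (σ m)`. -/
structure EquivariantModule (k Γ G N : Type*) [Field k] [Group Γ] [Group G]
    [MulDistribMulAction Γ G] [AddCommGroup N] [Module k N] where
  /-- the action of `G` -/
  repG : Representation k G N
  /-- the action of `Γ` -/
  repΓ : Representation k Γ N
  compat : ∀ (σ : Γ) (g : G) (m : N), repΓ σ (repG g m) = repG (σ • g) (repΓ σ m)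

/-- The field `k` with the trivial actions of `G` and `Γ`. -/
def EquivariantModule.trivial (k Γ G : Type*) [Field k] [Group Γ] [Group G]
    [MulDistribMulAction Γ G] : EquivariantModule k Γ G k where
  repG := Representation.trivial k G k
  repΓ := Representation.trivial k Γ k
  compat := fun _ _ _ => rfl

variable {k Γ G N : Type*} [Field k] [Group Γ] [Group G] [MulDistribMulAction Γ G]
  [AddCommGroup N] [Module k N] (E : EquivariantModule k Γ G N)

/-- The differential `∂ⁿ : Maps(Gⁿ, N) → Maps(Gⁿ⁺¹, N)`:
`(∂φ)(g₁,…,gₙ₊₁) = g₁ φ(g₂,…,gₙ₊₁) + ∑_{j=1}^n (-1)^j φ(g₁,…,gⱼgⱼ₊₁,…,gₙ₊₁) + (-1)^{n+1} φ(g₁,…,gₙ)`.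
The index `j` is shifted by one in the code. -/
def groupD (n : ℕ) : ((Fin n → G) → N) →ₗ[k] ((Fin (n + 1) → G) → N) where
  toFun f g := E.repG (g 0) (f (Fin.tail g))
    + ∑ j : Fin n, (-1 : k) ^ ((j : ℕ) + 1) • f (Fin.contractNth j.castSucc (· * ·) g)
    + (-1 : k) ^ (n + 1) • f (Fin.init g)
  map_add' f f' := by
    funext g
    simp only [Pi.add_apply, map_add, smul_add, Finset.sum_add_distrib]
    abel
  map_smul' c f := by
    funext g
    simp only [Pi.smul_apply, map_smul, smul_add, Finset.smul_sum, RingHom.id_apply,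
      smul_comm c]

/-- `C_Γⁿ(G, N)`, the space of `Γ`-maps `Gⁿ → N`. -/
def groupCochains (n : ℕ) : Submodule k ((Fin n → G) → N) where
  carrier := {f | ∀ (σ : Γ) (g : Fin n → G), f (fun i => σ • g i) = E.repΓ σ (f g)}
  add_mem' := fun ha hb σ g => by simp only [Pi.add_apply, ha σ g, hb σ g, map_add]
  zero_mem' := fun σ g => by simp
  smul_mem' := fun c f hf σ g => by simp only [Pi.smul_apply, hf σ g, map_smul]

/-- The equivariant `n`-cocycles: the kernel of `∂ⁿ` on `C_Γⁿ(G, N)`. -/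
def groupCocycles (n : ℕ) : Submodule k ((Fin n → G) → N) :=
  groupCochains E n ⊓ LinearMap.ker (groupD E n)

/-- The equivariant `n`-coboundaries: the image of `C_Γⁿ⁻¹(G, N)` under `∂ⁿ⁻¹` (zero for `n = 0`). -/
def groupCoboundaries : (n : ℕ) → Submodule k ((Fin n → G) → N)
  | 0 => ⊥
  | n + 1 => (groupCochains E n).map (groupD E n)

/-- `H_Γⁿ(G, N) = Ker ∂ⁿ / Im ∂ⁿ⁻¹`. -/
abbrev GroupCohomology (n : ℕ) : Type _ :=
  groupCocycles E n ⧸ (groupCoboundaries E n).submoduleOf (groupCocycles E n)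

/-- The cohomology class of an equivariant cocycle. -/
def groupClass {n : ℕ} : groupCocycles E n →ₗ[k] GroupCohomology E n :=
  Submodule.mkQ _

end GroupCohomology

/-! ### Equivariant Hochschild cohomology -/

section Hochschild

open MulOpposite

/-- Replacing `aᵢ` by `v` in `(a₁,…,aₙ₊₁)` changes exactly one entry of
`(a₁,…,aⱼaⱼ₊₁,…,aₙ₊₁)`, and that entry depends linearly on `v`. -/
theorem exists_contractNth_update {k A : Type*} [Field k] [Ring A] [Algebra k A] {n : ℕ}
    [DecidableEq (Fin (n + 1))] (j : Fin n) (a : Fin (n + 1) → A) (i : Fin (n + 1)) :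
    ∃ (l : Fin n) (L : A →ₗ[k] A), ∀ v : A,
      Fin.contractNth j.castSucc (· * ·) (Function.update a i v) =
        Function.update (Fin.contractNth j.castSucc (· * ·) a) l (L v) := by
  rcases lt_trichotomy (i : ℕ) (j : ℕ) with h | h | h
  · refine ⟨⟨i, by omega⟩, LinearMap.id, fun v => ?_⟩
    funext l
    simp only [Fin.contractNth, Function.update_apply, Fin.ext_iff, Fin.val_castSucc, Fin.val_succ,
      LinearMap.id_apply]
    grind
  · refine ⟨⟨i, by omega⟩, LinearMap.mulRight k (a j.succ), fun v => ?_⟩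
    funext l
    simp only [Fin.contractNth, Function.update_apply, Fin.ext_iff, Fin.val_castSucc, Fin.val_succ,
      LinearMap.mulRight_apply]
    by_cases hl : (l : ℕ) = j
    · obtain rfl : l = j := Fin.ext hl
      simp [h]
    · grind
  · by_cases h1 : (i : ℕ) = j + 1
    · refine ⟨j, LinearMap.mulLeft k (a j.castSucc), fun v => ?_⟩
      funext l
      simp only [Fin.contractNth, Function.update_apply, Fin.ext_iff, Fin.val_castSucc,
        Fin.val_succ, LinearMap.mulLeft_apply]
      by_cases hl : (l : ℕ) = j
      · obtain rfl : l = j := Fin.ext hl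
        simp [h1]
      · grind
    · refine ⟨⟨i - 1, by omega⟩, LinearMap.id, fun v => ?_⟩
      funext l
      simp only [Fin.contractNth, Function.update_apply, Fin.ext_iff, Fin.val_castSucc,
        Fin.val_succ, LinearMap.id_apply]
      grind

variable {k Γ A M : Type*} [Field k] [Group Γ] [Ring A] [Algebra k A]
  [AddCommGroup M] [Module k M] [Module A M] [Module Aᵐᵒᵖ M]
  [IsScalarTower k A M] [IsScalarTower k Aᵐᵒᵖ M]

/-- `Cⁿ(A, M)`: linear maps `A^{⊗n} → M`, given as `k`-multilinear maps `Aⁿ → M`. -/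
abbrev HochschildCochain (k A M : Type*) [Field k] [Ring A] [Algebra k A]
    [AddCommGroup M] [Module k M] (n : ℕ) : Type _ :=
  MultilinearMap k (fun _ : Fin n => A) M

/-- The cochain `(a₁,…,aₙ₊₁) ↦ φ(a₁,…,aⱼaⱼ₊₁,…,aₙ₊₁)` (with `j` counted from `0`). -/
def hochschildContract {n : ℕ} (φ : HochschildCochain k A M n) (j : Fin n) :
    HochschildCochain k A M (n + 1) where
  toFun a := φ (Fin.contractNth j.castSucc (· * ·) a)
  map_update_add' a i v w := by
    obtain ⟨l, L, h⟩ := exists_contractNth_update (k := k) j a i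
    simp only [h, map_add, MultilinearMap.map_update_add]
  map_update_smul' a i c v := by
    obtain ⟨l, L, h⟩ := exists_contractNth_update (k := k) j a i
    simp only [h, map_smul, MultilinearMap.map_update_smul]

/-- The cochain `(a₁,…,aₙ₊₁) ↦ a₁ · φ(a₂,…,aₙ₊₁)`. -/
def hochschildLeft {n : ℕ} (φ : HochschildCochain k A M n) : HochschildCochain k A M (n + 1) where
  toFun a := a 0 • φ (Fin.tail a)
  map_update_add' a i v w := by
    rename_i inst
    rw [Subsingleton.elim inst (instDecidableEqFin (n + 1))]
    refine Fin.cases ?_ (fun i => ?_) i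
    · simp [add_smul]
    · simp [Fin.tail_update_succ, (Fin.succ_ne_zero i).symm]
  map_update_smul' a i c v := by
    rename_i inst
    rw [Subsingleton.elim inst (instDecidableEqFin (n + 1))]
    refine Fin.cases ?_ (fun i => ?_) i
    · simp
    · simp [Fin.tail_update_succ, (Fin.succ_ne_zero i).symm,
        smul_comm (a 0) c]

/-- The cochain `(a₁,…,aₙ₊₁) ↦ φ(a₁,…,aₙ) · aₙ₊₁`. -/
def hochschildRight {n : ℕ} (φ : HochschildCochain k A M n) :
    HochschildCochain k A M (n + 1) where
  toFun a := op (a (Fin.last n)) • φ (Fin.init a)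
  map_update_add' a i v w := by
    rename_i inst
    rw [Subsingleton.elim inst (instDecidableEqFin (n + 1))]
    refine Fin.lastCases ?_ (fun i => ?_) i
    · simp [add_smul]
    · simp [Fin.init_update_castSucc, (Fin.castSucc_lt_last i).ne']
  map_update_smul' a i c v := by
    rename_i inst
    rw [Subsingleton.elim inst (instDecidableEqFin (n + 1))]
    refine Fin.lastCases ?_ (fun i => ?_) i
    · simp
    · simp [Fin.init_update_castSucc, (Fin.castSucc_lt_last i).ne',
        smul_comm (op (a (Fin.last n))) c]

/-- The Hochschild differential `δⁿ : Cⁿ(A, M) → Cⁿ⁺¹(A, M)`,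
`(δφ)(a₁,…,aₙ₊₁) = a₁ φ(a₂,…,aₙ₊₁) + ∑_{j=1}^n (-1)^j φ(a₁,…,aⱼaⱼ₊₁,…,aₙ₊₁)
  + (-1)^{n+1} φ(a₁,…,aₙ) aₙ₊₁`. -/
def hochschildD (n : ℕ) : HochschildCochain k A M n →ₗ[k] HochschildCochain k A M (n + 1) where
  toFun φ := hochschildLeft φ
    + ∑ j : Fin n, (-1 : k) ^ ((j : ℕ) + 1) • hochschildContract φ j
    + (-1 : k) ^ (n + 1) • hochschildRight φ
  map_add' φ φ' := by
    ext a
    simp [hochschildLeft, hochschildRight, hochschildContract, Finset.sum_add_distrib]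
    abel
  map_smul' c φ := by
    ext a
    simp [hochschildLeft, hochschildRight, hochschildContract, Finset.smul_sum, smul_comm c]

theorem hochschildD_apply (n : ℕ) (φ : HochschildCochain k A M n) (a : Fin (n + 1) → A) :
    hochschildD n φ a = a 0 • φ (Fin.tail a)
      + ∑ j : Fin n, (-1 : k) ^ ((j : ℕ) + 1) • φ (Fin.contractNth j.castSucc (· * ·) a)
      + (-1 : k) ^ (n + 1) • op (a (Fin.last n)) • φ (Fin.init a) := by
  simp [hochschildD, hochschildLeft, hochschildRight, hochschildContract]

/-- For a `Γ`-algebra `A` (with `Γ` acting through `α` by `k`-algebra automorphisms), the structure of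
a `Γ`-equivariant `(A-A)`-bimodule on an `(A-A)`-bimodule `M`: a linear action of `Γ` on `M`,
compatible with both `A`-actions. -/
structure EquivariantBimodule (α : Γ →* (A ≃ₐ[k] A)) (M : Type*) [AddCommGroup M] [Module k M]
    [Module A M] [Module Aᵐᵒᵖ M] [SMulCommClass A Aᵐᵒᵖ M] where
  /-- the action of `Γ` -/
  rep : Representation k Γ M
  map_left : ∀ (σ : Γ) (a : A) (m : M), rep σ (a • m) = α σ a • rep σ m
  map_right : ∀ (σ : Γ) (a : A) (m : M), rep σ (op a • m) = op (α σ a) • rep σ m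

/-- The `Γ`-algebra `A` as a `Γ`-equivariant bimodule over itself. -/
def EquivariantBimodule.regular (α : Γ →* (A ≃ₐ[k] A)) : EquivariantBimodule α A where
  rep :=
    { toFun := fun σ => (α σ).toLinearMap
      map_one' := by ext; simp
      map_mul' := fun σ τ => by ext; simp }
  map_left := fun σ a m => by simp
  map_right := fun σ a m => by simp

variable [SMulCommClass A Aᵐᵒᵖ M] {α : Γ →* (A ≃ₐ[k] A)} (E : EquivariantBimodule α M)

/-- `C_Γⁿ(A, M)`: the cochains `φ` with `φ(σa₁ ⊗ … ⊗ σaₙ) = σ φ(a₁ ⊗ … ⊗ aₙ)`. -/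
def hochschildCochains (n : ℕ) : Submodule k (HochschildCochain k A M n) where
  carrier := {φ | ∀ (σ : Γ) (a : Fin n → A), φ (fun i => α σ (a i)) = E.rep σ (φ a)}
  add_mem' := fun ha hb σ a => by simp only [add_apply, ha σ a, hb σ a, map_add]
  zero_mem' := fun σ a => by simp
  smul_mem' := fun c f hf σ a => by simp only [smul_apply, hf σ a, map_smul]

/-- The equivariant Hochschild `n`-cocycles: the kernel of `δⁿ` on `C_Γⁿ(A, M)`. -/
def hochschildCocycles (n : ℕ) : Submodule k (HochschildCochain k A M n) :=
  hochschildCochains E n ⊓ LinearMap.ker (hochschildD n)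

/-- The equivariant Hochschild `n`-coboundaries: the image of `C_Γⁿ⁻¹(A, M)` under `δⁿ⁻¹` (zero for
`n = 0`). -/
def hochschildCoboundaries : (n : ℕ) → Submodule k (HochschildCochain k A M n)
  | 0 => ⊥
  | n + 1 => (hochschildCochains E n).map (hochschildD n)

/-- `HH_Γⁿ(A, M) = Ker δⁿ / Im δⁿ⁻¹`. -/
abbrev HochschildCohomology (n : ℕ) : Type _ :=
  hochschildCocycles E n ⧸ (hochschildCoboundaries E n).submoduleOf (hochschildCocycles E n)

/-- The cohomology class of an equivariant Hochschild cocycle. -/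
def hochschildClass {n : ℕ} : hochschildCocycles E n →ₗ[k] HochschildCohomology E n :=
  Submodule.mkQ _

end Hochschild

/-! ### The group algebra and the centralizer of an element -/

section GroupAlgebra

/-- The centralizer `C_G(x)`. -/
abbrev Cent {G : Type*} [Group G] (x : G) : Subgroup G := Subgroup.centralizer {x}

/-- The stabilizer `Γ_x`. -/
abbrev Stab (Γ : Type*) {G : Type*} [Group Γ] [Group G] [MulDistribMulAction Γ G] (x : G) :
    Subgroup Γ := MulAction.stabilizer Γ x

/-- For a `Γ`-group `G` and `x ∈ G`, the group `Γ_x` acts on `C_G(x)` by restriction. -/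
instance stabActsOnCent {Γ G : Type*} [Group Γ] [Group G] [MulDistribMulAction Γ G] (x : G) :
    MulDistribMulAction (Stab Γ x) (Cent x) where
  smul σ h := ⟨σ • (h : G), by
    have hσ : (σ : Γ) • x = x := σ.2
    have hh := Subgroup.mem_centralizer_singleton_iff.mp h.2
    rw [Subgroup.mem_centralizer_singleton_iff]
    have := congrArg ((σ : Γ) • ·) hh
    simp only [smul_mul', hσ] at this
    exact this⟩
  one_smul h := Subtype.ext (one_smul (Stab Γ x) (h : G))
  mul_smul σ τ h := Subtype.ext (mul_smul σ τ (h : G))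
  smul_mul σ h h' := Subtype.ext (smul_mul' σ (h : G) (h' : G))
  smul_one σ := Subtype.ext (smul_one σ)

theorem coe_stab_smul {Γ G : Type*} [Group Γ] [Group G] [MulDistribMulAction Γ G] (x : G)
    (σ : Stab Γ x) (h : Cent x) : ((σ • h : Cent x) : G) = (σ : Γ) • (h : G) := rfl

/-- For a `Γ`-group `G`, the action of `Γ` on `kG` by algebra automorphisms that extends the action
on `G` linearly. -/
def groupAlgebraAction (k Γ G : Type*) [Field k] [Group Γ] [Group G] [MulDistribMulAction Γ G] :
    Γ →* (MonoidAlgebra k G ≃ₐ[k] MonoidAlgebra k G) :=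
  (MonoidAlgebra.domCongrAut (R := k) (A := k) (M := G)).comp (MulDistribMulAction.toMulAut Γ G)

theorem groupAlgebraAction_single {k Γ G : Type*} [Field k] [Group Γ] [Group G]
    [MulDistribMulAction Γ G] (σ : Γ) (g : G) (c : k) :
    groupAlgebraAction k Γ G σ (MonoidAlgebra.single g c) = MonoidAlgebra.single (σ • g) c := by
  simp [groupAlgebraAction]

/-- `H_{Γ_x}ⁿ(C_G(x), k)` is the cohomology of the trivial module. -/
abbrev centModule (k Γ : Type*) {G : Type*} [Field k] [Group Γ] [Group G]
    [MulDistribMulAction Γ G] (x : G) : EquivariantModule k (Stab Γ x) (Cent x) k :=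
  EquivariantModule.trivial k (Stab Γ x) (Cent x)

/-- `HH_{Γ_x}ⁿ(kG)` is the Hochschild cohomology of the bimodule `kG` over the `Γ_x`-algebra `kG`. -/
abbrev groupAlgebraBimodule (k Γ : Type*) {G : Type*} [Field k] [Group Γ] [Group G]
    [MulDistribMulAction Γ G] (x : G) :
    EquivariantBimodule (groupAlgebraAction k (Stab Γ x) G) (MonoidAlgebra k G) :=
  EquivariantBimodule.regular (groupAlgebraAction k (Stab Γ x) G)

end GroupAlgebra

/-! ### The maps `π` and `ν` -/

section Maps

variable {k G : Type*} [Field k] [Group G]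

/-- `πⁿ(φ)(h₁,…,hₙ)` is the coefficient of `x` in `φ(h₁ ⊗ … ⊗ hₙ) hₙ⁻¹ ⋯ h₁⁻¹`. -/
def piMap (k : Type*) [Field k] (x : G) (n : ℕ) :
    HochschildCochain k (MonoidAlgebra k G) (MonoidAlgebra k G) n →ₗ[k]
      ((Fin n → Cent x) → k) where
  toFun φ h := (φ (fun i => MonoidAlgebra.single (h i : G) 1) *
    MonoidAlgebra.single (List.ofFn fun i => (h i : G)).prod⁻¹ 1).coeff x
  map_add' φ φ' := by
    funext h
    simp [add_mul]
  map_smul' c φ := by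
    funext h
    simp

variable {x : G} {S : Set G} (hS : Subgroup.IsComplement (Cent x : Set G) S)

/-- For a system `S` of representatives with `G = ⨆_{γ ∈ S} C_G(x) γ`, an element `γ` of `S`, and
`g₁,…,gₙ ∈ G`: the representatives `γ = γ^0, γ^1, …, γ^n` in `S` with
`γ^{i-1} gᵢ ∈ C_G(x) γ^i`. -/
def cosetRep {n : ℕ} (γ : S) (g : Fin n → G) : Fin (n + 1) → S :=
  Fin.induction γ (fun i s => (hS.equiv ((s : G) * g i)).2)

/-- The elements `h₁,…,hₙ ∈ C_G(x)` with `γ^{i-1} gᵢ = hᵢ γ^i`. -/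
def cosetElt {n : ℕ} (γ : S) (g : Fin n → G) (i : Fin n) : Cent x :=
  (hS.equiv ((cosetRep hS γ g i.castSucc : G) * g i)).1

theorem cosetRep_zero {n : ℕ} (γ : S) (g : Fin n → G) : cosetRep hS γ g 0 = γ := rfl

theorem cosetRep_mul {n : ℕ} (γ : S) (g : Fin n → G) (i : Fin n) :
    (cosetRep hS γ g i.castSucc : G) * g i =
      (cosetElt hS γ g i : G) * (cosetRep hS γ g i.succ : G) :=
  (hS.equiv_fst_mul_equiv_snd _).symm

/-- `∑_{γ ∈ S} ψ(h_{γ,1},…,h_{γ,n}) (γ⁻¹ x γ) g₁ ⋯ gₙ`, the value of `νⁿ(ψ)` at `g₁ ⊗ … ⊗ gₙ`. -/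
def nuValue [Fintype S] {n : ℕ} (ψ : (Fin n → Cent x) → k) (g : Fin n → G) : MonoidAlgebra k G :=
  ∑ γ : S, MonoidAlgebra.single ((γ : G)⁻¹ * x * (γ : G) * (List.ofFn g).prod)
    (ψ (cosetElt hS γ g))

/-- `νⁿ(ψ)`: the multilinear extension to `kG` of
`(g₁,…,gₙ) ↦ ∑_{γ ∈ S} ψ(h_{γ,1},…,h_{γ,n}) (γ⁻¹ x γ) g₁ ⋯ gₙ`. -/
def nuMap (k : Type*) [Field k] [Fintype G] [Fintype S] (n : ℕ) :
    ((Fin n → Cent x) → k) →ₗ[k]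
      HochschildCochain k (MonoidAlgebra k G) (MonoidAlgebra k G) n where
  toFun ψ := ∑ g : Fin n → G,
    (MultilinearMap.mkPiRing k (Fin n) (nuValue hS ψ g)).compLinearMap
      (fun i => Finsupp.lapply (g i) ∘ₗ (MonoidAlgebra.coeffLinearEquiv k).toLinearMap)
  map_add' ψ ψ' := by
    ext a : 1
    simp [nuValue, Finset.sum_add_distrib]
  map_smul' c ψ := by
    ext a : 1
    simp [nuValue, Finset.smul_sum, mul_left_comm]

theorem nuMap_single [Fintype G] [Fintype S] {n : ℕ} (ψ : (Fin n → Cent x) → k) (g : Fin n → G) :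
    nuMap hS k n ψ (fun i => MonoidAlgebra.single (g i) 1) =
      ∑ γ : S, MonoidAlgebra.single ((γ : G)⁻¹ * x * (γ : G) * (List.ofFn g).prod)
        (ψ (cosetElt hS γ g)) := by
  classical
  change _ = nuValue hS ψ g
  simp only [nuMap, LinearMap.coe_mk, AddHom.coe_mk, sum_apply]
  rw [Finset.sum_eq_single g]
  · simp
  · intro g' _ hne
    obtain ⟨i, hi⟩ := Function.ne_iff.mp hne
    have : (∏ i, (Finsupp.single (g i) (1 : k)) (g' i)) = 0 :=
      Finset.prod_eq_zero (Finset.mem_univ i) (by simp [hi])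
    simp [this]
  · simp

end Maps

end EquivCoh

end

open EquivCoh

open EquivCoh

/-! Already on cochains, `π ∘ ν` is the identity (`piMap_nuMap`). In the sum defining
`ν(ψ)(h₁,…,hₙ)`, the coefficient that `π` reads off only sees those `γ` with `γ⁻¹xγ = x`, that is `γ
∈ C_G(x)`, and `1` is the only such representative; for `γ = 1` the elements `h_{γ,i}` are the `hᵢ`
themselves. So once both maps pass to cohomology, the left inverse and injectivity are automatic.

The work lies in showing that `ν` is an equivariant cochain map. View `γ⁰, γ¹, …, γⁿ` as a path in
`S` with steps `gᵢ` and labels `hᵢ`. The relations `γ^{i-1}gᵢ = hᵢγ^i` determine the path and its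
labels from its start (`cosetRep_eq`, `cosetElt_eq`), so the effect of each face map and of `σ` is
found by exhibiting a path. Only the first face moves the start, from `γ` to `γ¹`; this is absorbed
by reindexing the sum over `S` (`bijective_rep_mul`).

For `π`, the differential is respected because `x` commutes with `h₁`, and equivariance holds
because `σ` fixes `x`. -/

namespace EquivCoh

open MulOpposite

/-! ### Products of tuples under the face maps -/

section Products

variable {M : Type*}

theorem prod_ofFn_eq_partialProd_last [Monoid M] {n : ℕ} (g : Fin n → M) :
    (List.ofFn g).prod = Fin.partialProd g (Fin.last n) := by
  simp [Fin.partialProd, List.take_of_length_le]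

theorem prod_ofFn_contractNth [Monoid M] {n : ℕ} (j : Fin n) (g : Fin (n + 1) → M) :
    (List.ofFn (Fin.contractNth j.castSucc (· * ·) g)).prod = (List.ofFn g).prod := by
  cases n with
  | zero => exact j.elim0
  | succ n =>
    -- Contraction omits one intermediate partial product, so the last one is unchanged.
    have h := congrFun (Fin.partialProd_contractNth g j.castSucc) (Fin.last _)
    rw [prod_ofFn_eq_partialProd_last, prod_ofFn_eq_partialProd_last, h, Function.comp_apply,
      Fin.succAbove_of_le_castSucc, Fin.succ_last]
    rw [Fin.le_def]
    simp only [Fin.val_succ, Fin.val_castSucc, Fin.val_last]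
    omega

theorem prod_ofFn_tail [Monoid M] {n : ℕ} (g : Fin (n + 1) → M) :
    (List.ofFn g).prod = g 0 * (List.ofFn (Fin.tail g)).prod := by
  rw [List.ofFn_succ, List.prod_cons]
  rfl

theorem prod_ofFn_init [Monoid M] {n : ℕ} (g : Fin (n + 1) → M) :
    (List.ofFn g).prod = (List.ofFn (Fin.init g)).prod * g (Fin.last n) := by
  rw [List.ofFn_succ', List.concat_eq_append, List.prod_append, List.prod_singleton]
  rfl

theorem prod_ofFn_map {P F : Type*} [Monoid M] [Monoid P] [FunLike F M P] [MonoidHomClass F M P]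
    (f : F) {n : ℕ} (g : Fin n → M) :
    (List.ofFn fun i => f (g i)).prod = f (List.ofFn g).prod := by
  rw [map_list_prod, List.map_ofFn]
  rfl

theorem comp_contractNth {P : Type*} [Mul M] [Mul P] (f : M → P)
    (hf : ∀ a b, f (a * b) = f a * f b) {n : ℕ} (j : Fin n) (g : Fin (n + 1) → M) (i : Fin n) :
    f (Fin.contractNth j.castSucc (· * ·) g i) =
      Fin.contractNth j.castSucc (· * ·) (fun l => f (g l)) i := by
  rcases lt_trichotomy (i : ℕ) (j.castSucc : Fin (n + 1)) with h | h | h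
  · simp only [Fin.contractNth_apply_of_lt _ _ _ _ h]
  · simp only [Fin.contractNth_apply_of_eq _ _ _ _ h, hf]
  · simp only [Fin.contractNth_apply_of_gt _ _ _ _ h]

end Products

/-! ### Paths of coset representatives and their labels in the centralizer -/

section CosetDecomposition

variable {G : Type*} [Group G] {x : G} {S : Set G}
  (hS : Subgroup.IsComplement (Cent x : Set G) S)

theorem cent_mul_rep_injective (hS : Subgroup.IsComplement (Cent x : Set G) S) {h h' : Cent x} {γ γ' : S}
    (H : (h : G) * γ = (h' : G) * γ') : h = h' ∧ γ = γ' := by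
  have := @hS.1 (h, γ) (h', γ') H
  exact Prod.ext_iff.mp this

theorem equiv_eq_of_eq_mul {a : G} {h : Cent x} {γ : S} (H : a = (h : G) * γ) :
    hS.equiv a = (h, γ) := by
  obtain ⟨h1, h2⟩ := cent_mul_rep_injective hS ((hS.equiv_fst_mul_equiv_snd a).trans H)
  exact Prod.ext h1 h2

/-- Uniqueness of the decomposition `G = ⨆ C_G(x) γ` propagates along the path by induction. Writing
the start as `s 0` lets each application supply only the path `s` and its labels. -/
theorem cosetRep_eq {n : ℕ} {g : Fin n → G} {s : Fin (n + 1) → S} {h : Fin n → Cent x}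
    (H : ∀ i, (s i.castSucc : G) * g i = (h i : G) * s i.succ) :
    cosetRep hS (s 0) g = s := by
  funext i
  induction i using Fin.induction with
  | zero => rfl
  | succ i ih =>
    have : cosetRep hS (s 0) g i.succ =
      (hS.equiv ((cosetRep hS (s 0) g i.castSucc : G) * g i)).2 := rfl
    rw [this, ih, equiv_eq_of_eq_mul hS (H i)]

theorem cosetElt_eq {n : ℕ} {g : Fin n → G} {s : Fin (n + 1) → S} {h : Fin n → Cent x}
    (H : ∀ i, (s i.castSucc : G) * g i = (h i : G) * s i.succ) :
    cosetElt hS (s 0) g = h := by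
  funext i
  rw [cosetElt, cosetRep_eq hS H, equiv_eq_of_eq_mul hS (H i)]

theorem cosetElt_tail {n : ℕ} (γ : S) (g : Fin (n + 1) → G) :
    cosetElt hS (cosetRep hS γ g 1) (Fin.tail g) = Fin.tail (cosetElt hS γ g) :=
  cosetElt_eq hS (s := Fin.tail (cosetRep hS γ g)) fun i => cosetRep_mul hS γ g i.succ

theorem cosetElt_init {n : ℕ} (γ : S) (g : Fin (n + 1) → G) :
    cosetElt hS γ (Fin.init g) = Fin.init (cosetElt hS γ g) :=
  cosetElt_eq hS (s := Fin.init (cosetRep hS γ g)) fun i => cosetRep_mul hS γ g i.castSucc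

theorem cosetElt_contractNth {n : ℕ} (γ : S) (g : Fin (n + 1) → G) (j : Fin n) :
    cosetElt hS γ (Fin.contractNth j.castSucc (· * ·) g) =
      Fin.contractNth j.castSucc (· * ·) (cosetElt hS γ g) := by
  have h0 : (j.castSucc.succ).succAbove 0 = 0 := Fin.succ_succAbove_zero _
  -- Merging two adjacent steps deletes the vertex between them, which has index `j + 1` counted
  -- from `0`. It is never the start, by `h0`.
  have key := cosetElt_eq hS (g := Fin.contractNth j.castSucc (· * ·) g)
    (s := fun l => cosetRep hS γ g (j.castSucc.succ.succAbove l))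
    (h := Fin.contractNth j.castSucc (· * ·) (cosetElt hS γ g)) ?_
  · simpa only [h0, cosetRep_zero] using key
  intro i
  have e1 := cosetRep_mul hS γ g i.castSucc
  have e2 := cosetRep_mul hS γ g i.succ
  rcases lt_trichotomy (i : ℕ) (j.castSucc : Fin (n + 1)) with h | h | h
  · rw [Fin.contractNth_apply_of_lt _ _ _ _ h, Fin.contractNth_apply_of_lt _ _ _ _ h,
      Fin.succAbove_of_castSucc_lt _ i.castSucc, Fin.succAbove_of_castSucc_lt _ i.succ]
    · exact e1
    all_goals simp only [Fin.lt_def, Fin.val_castSucc, Fin.val_succ] at h ⊢; omega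
  · rw [Fin.contractNth_apply_of_eq _ _ _ _ h, Fin.contractNth_apply_of_eq _ _ _ _ h,
      Fin.succAbove_of_castSucc_lt _ i.castSucc, Fin.succAbove_of_le_castSucc _ i.succ]
    -- At the merged step the two relations compose, and the labels multiply in the same order.
    · rw [← mul_assoc, e1, mul_assoc, Fin.succ_castSucc, e2, Subgroup.coe_mul, mul_assoc]
    all_goals simp only [Fin.lt_def, Fin.le_def, Fin.val_castSucc, Fin.val_succ] at h ⊢; omega
  · rw [Fin.contractNth_apply_of_gt _ _ _ _ h, Fin.contractNth_apply_of_gt _ _ _ _ h,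
      Fin.succAbove_of_le_castSucc _ i.castSucc, Fin.succAbove_of_le_castSucc _ i.succ]
    · exact e2
    all_goals simp only [Fin.le_def, Fin.val_castSucc, Fin.val_succ] at h ⊢; omega

/-- The path is constant at `1`, since `1 · hᵢ = hᵢ · 1`. -/
theorem cosetElt_one (hone : (1 : G) ∈ S) {n : ℕ} (h : Fin n → Cent x) :
    cosetElt hS ⟨1, hone⟩ (fun i => (h i : G)) = h :=
  cosetElt_eq hS (s := fun _ => ⟨1, hone⟩) fun i => by simp

/-- Right translation by `a` permutes the cosets `C_G(x) γ`, hence their representatives. -/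
theorem bijective_rep_mul [Finite S] (a : G) :
    Function.Bijective fun γ : S => (hS.equiv ((γ : G) * a)).2 := by
  refine Finite.injective_iff_bijective.mp fun γ γ' H => ?_
  have e := hS.equiv_fst_mul_equiv_snd ((γ : G) * a)
  have e' := hS.equiv_fst_mul_equiv_snd ((γ' : G) * a)
  change (hS.equiv ((γ : G) * a)).2 = (hS.equiv ((γ' : G) * a)).2 at H
  generalize hS.equiv ((γ : G) * a) = p at H e
  generalize hS.equiv ((γ' : G) * a) = q at H e'
  -- With `r` the common representative of `γa` and `γ'a`, both `p.1⁻¹γ` and `q.1⁻¹γ'` equal `ra⁻¹`.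
  refine (cent_mul_rep_injective hS (h := p.1⁻¹) (h' := q.1⁻¹) (mul_right_cancel (b := a) ?_)).2
  rw [mul_assoc, mul_assoc, ← e, ← e', H, Subgroup.coe_inv, Subgroup.coe_inv,
    inv_mul_cancel_left, inv_mul_cancel_left]

/-- The element `γ⁻¹ x γ` only depends on the coset `C_G(x) γ`. -/
theorem inv_mul_mul_cent_mul (h : Cent x) (γ : G) :
    ((h : G) * γ)⁻¹ * x * ((h : G) * γ) = γ⁻¹ * x * γ := by
  have hh : (h : G) * x = x * h := Subgroup.mem_centralizer_singleton_iff.mp h.2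
  have : (h : G)⁻¹ * x * h = x := by rw [mul_assoc, ← hh, inv_mul_cancel_left]
  calc ((h : G) * γ)⁻¹ * x * ((h : G) * γ) = γ⁻¹ * ((h : G)⁻¹ * x * h) * γ := by group
    _ = γ⁻¹ * x * γ := by rw [this]

/-- A representative commuting with `x` lies in the coset `C_G(x) · 1`, which is already represented
by `1`. -/
theorem inv_mul_mul_rep_eq_iff (hS : Subgroup.IsComplement (Cent x : Set G) S)
    (hone : (1 : G) ∈ S) (γ : S) :
    (γ : G)⁻¹ * x * γ = x ↔ γ = ⟨1, hone⟩ := by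
  refine ⟨fun H => ?_, fun H => by simp [H]⟩
  have hγ : (γ : G) ∈ Cent x := by
    rw [Subgroup.mem_centralizer_singleton_iff]
    rw [mul_assoc, inv_mul_eq_iff_eq_mul] at H
    exact H.symm
  exact (cent_mul_rep_injective hS (h := 1) (h' := ⟨γ, hγ⟩) (by simp)).2

/-- Applying `σ` to every relation gives a path again: its vertices stay in `S` by stability, and
its labels stay in `C_G(x)` because `σ` fixes `x`. -/
theorem cosetElt_smul {Γ : Type*} [Group Γ] [MulDistribMulAction Γ G] (σ : Stab Γ x)
    (hσ : ∀ γ ∈ S, σ • γ ∈ S) {n : ℕ} (γ : S) (g : Fin n → G) :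
    cosetElt hS ⟨σ • (γ : G), hσ γ γ.2⟩ (fun i => σ • g i) =
      fun i => σ • cosetElt hS γ g i := by
  refine cosetElt_eq hS (s := fun i => ⟨σ • (cosetRep hS γ g i : G), hσ _ (Subtype.coe_prop _)⟩)
    fun i => ?_
  have := congrArg (σ • ·) (cosetRep_mul hS γ g i)
  simp only [smul_mul'] at this
  exact this

end CosetDecomposition

/-! ### Differentials and equivariance of `π` and `ν` on cochains -/

section Cochains

variable {k G : Type*} [Field k] [Group G] {x : G}

theorem hochschildCochain_ext {n : ℕ}
    {φ φ' : HochschildCochain k (MonoidAlgebra k G) (MonoidAlgebra k G) n}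
    (h : ∀ g : Fin n → G, φ (fun i => MonoidAlgebra.single (g i) 1) =
      φ' (fun i => MonoidAlgebra.single (g i) 1)) : φ = φ' := by
  refine Module.Basis.ext_multilinear (fun _ => MonoidAlgebra.basis G k) fun v => ?_
  simpa using h v

theorem contractNth_single {n : ℕ} (j : Fin n) (g : Fin (n + 1) → G) :
    Fin.contractNth j.castSucc (· * ·) (fun i => MonoidAlgebra.single (g i) (1 : k)) =
      fun i => MonoidAlgebra.single (Fin.contractNth j.castSucc (· * ·) g i) 1 := by
  funext i
  exact (comp_contractNth (fun a : G => MonoidAlgebra.single a (1 : k)) (by simp) j g i).symm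

theorem hochschildD_single {n : ℕ}
    (φ : HochschildCochain k (MonoidAlgebra k G) (MonoidAlgebra k G) n) (g : Fin (n + 1) → G) :
    hochschildD n φ (fun i => MonoidAlgebra.single (g i) 1) =
      MonoidAlgebra.single (g 0) 1 * φ (fun i => MonoidAlgebra.single (Fin.tail g i) 1)
      + ∑ j : Fin n, (-1 : k) ^ ((j : ℕ) + 1) •
          φ (fun i => MonoidAlgebra.single (Fin.contractNth j.castSucc (· * ·) g i) 1)
      + (-1 : k) ^ (n + 1) • (φ (fun i => MonoidAlgebra.single (Fin.init g i) 1) *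
          MonoidAlgebra.single (g (Fin.last n)) 1) := by
  rw [hochschildD_apply]
  simp only [contractNth_single, smul_eq_mul, op_smul_eq_mul]
  rfl

theorem groupD_trivial_apply {Γ : Type*} [Group Γ] [MulDistribMulAction Γ G] {n : ℕ}
    (ψ : (Fin n → Cent x) → k) (h : Fin (n + 1) → Cent x) :
    groupD (centModule k Γ x) n ψ h = ψ (Fin.tail h)
      + ∑ j : Fin n, (-1 : k) ^ ((j : ℕ) + 1) * ψ (Fin.contractNth j.castSucc (· * ·) h)
      + (-1 : k) ^ (n + 1) * ψ (Fin.init h) := rfl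

/-- Right multiplication by the inverse of a group element `p` moves the coefficient at `xp` to `x`.
-/
theorem piMap_apply {n : ℕ}
    (φ : HochschildCochain k (MonoidAlgebra k G) (MonoidAlgebra k G) n) (h : Fin n → Cent x) :
    piMap k x n φ h = (φ (fun i => MonoidAlgebra.single (h i : G) 1)).coeff
      (x * (List.ofFn fun i => (h i : G)).prod) := by
  simp [piMap]

theorem groupAlgebraAction_coeff {Γ : Type*} [Group Γ] [MulDistribMulAction Γ G] (σ : Γ)
    (a : MonoidAlgebra k G) (g : G) :
    (groupAlgebraAction k Γ G σ a).coeff (σ • g) = a.coeff g := by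
  classical
  induction a using MonoidAlgebra.induction_linear with
  | zero => simp
  | add a b ha hb => simp [ha, hb]
  | single g' c => simp [groupAlgebraAction_single, Finsupp.single_apply]

theorem groupD_piMap {Γ : Type*} [Group Γ] [MulDistribMulAction Γ G] {n : ℕ}
    (φ : HochschildCochain k (MonoidAlgebra k G) (MonoidAlgebra k G) n) :
    groupD (centModule k Γ x) n (piMap k x n φ) = piMap k x (n + 1) (hochschildD n φ) := by
  funext h
  have hx : x * (h 0 : G) = h 0 * x := (Subgroup.mem_centralizer_singleton_iff.mp (h 0).2).symm
  have hc : ∀ (j : Fin n) (i : Fin n),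
      ((Fin.contractNth j.castSucc (· * ·) h i : Cent x) : G) =
        Fin.contractNth j.castSucc (· * ·) (fun l => (h l : G)) i :=
    fun j i => comp_contractNth (fun a : Cent x => (a : G)) (fun _ _ => rfl) j h i
  rw [piMap_apply, hochschildD_single, groupD_trivial_apply]
  simp only [piMap_apply, hc, prod_ofFn_contractNth, MonoidAlgebra.coeff_add,
    MonoidAlgebra.coeff_smul, MonoidAlgebra.coeff_sum, Finsupp.add_apply, Finsupp.smul_apply,
    Finsupp.finsetSum_apply, smul_eq_mul]
  congr 2
  -- First face: `x h₁ ⋯ = h₁ x ⋯`, so the left factor `h₁` cancels. In the last face the right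
  -- factor cancels directly.
  · rw [prod_ofFn_tail, ← mul_assoc, hx, mul_assoc]
    simp [Fin.tail_def]
  · rw [prod_ofFn_init, ← mul_assoc]
    simp [Fin.init_def]

theorem piMap_mem_groupCochains {Γ : Type*} [Group Γ] [MulDistribMulAction Γ G] {n : ℕ}
    {φ : HochschildCochain k (MonoidAlgebra k G) (MonoidAlgebra k G) n}
    (hφ : φ ∈ hochschildCochains (groupAlgebraBimodule k Γ x) n) :
    piMap k x n φ ∈ groupCochains (centModule k Γ x) n := by
  intro σ h
  have e := hφ σ (fun i => MonoidAlgebra.single (h i : G) 1)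
  simp only [groupAlgebraAction_single] at e
  have hp : x * (List.ofFn fun i => ((σ • h i : Cent x) : G)).prod =
      σ • (x * (List.ofFn fun i => (h i : G)).prod) := by
    have hσ : σ • x = x := σ.2
    rw [smul_mul', hσ]
    exact congrArg _ (prod_ofFn_map (MulDistribMulAction.toMonoidHom G σ) _)
  rw [piMap_apply, piMap_apply, hp]
  refine (congrArg (fun a => MonoidAlgebra.coeff a _) e).trans ?_
  exact groupAlgebraAction_coeff σ _ _

variable {S : Set G} (hS : Subgroup.IsComplement (Cent x : Set G) S) [Fintype G] [Fintype S]

theorem piMap_nuMap (hone : (1 : G) ∈ S) {n : ℕ} (ψ : (Fin n → Cent x) → k) :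
    piMap k x n (nuMap hS k n ψ) = ψ := by
  classical
  funext h
  rw [piMap_apply, nuMap_single, MonoidAlgebra.coeff_sum, Finsupp.finsetSum_apply,
    Finset.sum_eq_single ⟨1, hone⟩]
  · simp [cosetElt_one]
  · intro γ _ hγ
    rw [MonoidAlgebra.coeff_single, Finsupp.single_eq_of_ne]
    rw [Ne, eq_comm, mul_left_inj]
    exact fun H => hγ ((inv_mul_mul_rep_eq_iff hS hone γ).mp H)
  · simp

theorem hochschildD_nuMap {Γ : Type*} [Group Γ] [MulDistribMulAction Γ G] {n : ℕ}
    (ψ : (Fin n → Cent x) → k) :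
    hochschildD n (nuMap hS k n ψ) = nuMap hS k (n + 1) (groupD (centModule k Γ x) n ψ) := by
  refine hochschildCochain_ext fun g => ?_
  rw [hochschildD_single]
  simp only [nuMap_single, groupD_trivial_apply, cosetElt_contractNth hS, cosetElt_init hS,
    prod_ofFn_contractNth, MonoidAlgebra.single_add, Finset.sum_add_distrib]
  congr 2
  -- First face: on the Hochschild side the sum is reindexed by `γ ↦ γ¹`. Since `γ¹ = h₁⁻¹γg₁`, this
  -- gives `g₁ (γ¹)⁻¹xγ¹ = γ⁻¹xγ g₁`, with `h₁` disappearing because it centralizes `x`.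
  · rw [← (bijective_rep_mul hS (g 0)).sum_comp, Finset.mul_sum]
    refine Finset.sum_congr rfl fun γ _ => ?_
    have h1 : (hS.equiv ((γ : G) * g 0)).2 = cosetRep hS γ g 1 := rfl
    have h2 : (cosetRep hS γ g 1 : G) = (cosetElt hS γ g 0 : G)⁻¹ * (γ * g 0) := by
      rw [eq_inv_mul_iff_mul_eq]
      exact (cosetRep_mul hS γ g 0).symm
    rw [h1, cosetElt_tail, MonoidAlgebra.single_mul_single, one_mul, prod_ofFn_tail g, h2,
      ← Subgroup.coe_inv, inv_mul_mul_cent_mul]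
    congr 1
    group
  · simp only [Finset.smul_sum, MonoidAlgebra.smul_single, smul_eq_mul]
    rw [Finset.sum_comm]
    refine Finset.sum_congr rfl fun γ _ => ?_
    exact (map_sum (MonoidAlgebra.singleAddHom _) _ _).symm
  · simp only [Finset.smul_sum, Finset.sum_mul, MonoidAlgebra.single_mul_single, mul_one,
      MonoidAlgebra.smul_single, smul_eq_mul, prod_ofFn_init g, mul_assoc]

theorem nuMap_mem_hochschildCochains {Γ : Type*} [Group Γ] [MulDistribMulAction Γ G]
    (hstable : ∀ σ ∈ Stab Γ x, (fun γ : G => σ • γ) '' S = S) {n : ℕ}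
    {ψ : (Fin n → Cent x) → k} (hψ : ψ ∈ groupCochains (centModule k Γ x) n) :
    nuMap hS k n ψ ∈ hochschildCochains (groupAlgebraBimodule k Γ x) n := by
  intro σ a
  have hσ : ∀ γ ∈ S, σ • γ ∈ S := fun γ hγ => (hstable σ σ.2).subset ⟨γ, hγ, rfl⟩
  have hσx : σ • x = x := σ.2
  have hbij : Function.Bijective fun γ : S => (⟨σ • (γ : G), hσ γ γ.2⟩ : S) :=
    Finite.injective_iff_bijective.mp fun γ γ' H =>
      Subtype.ext (MulAction.injective σ (congrArg Subtype.val H))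
  -- Equivariance on arbitrary arguments is phrased as an equality of two multilinear maps, so that
  -- it can be checked on group elements. There the sum is reindexed by the permutation `γ ↦ σγ` of
  -- `S`.
  have key : (nuMap hS k n ψ).compLinearMap
        (fun _ => (groupAlgebraAction k (Stab Γ x) G σ).toLinearMap) =
      (groupAlgebraAction k (Stab Γ x) G σ).toLinearMap.compMultilinearMap
        (nuMap hS k n ψ) := by
    refine hochschildCochain_ext fun g => ?_
    simp only [MultilinearMap.compLinearMap_apply, LinearMap.compMultilinearMap_apply,
      AlgEquiv.toLinearMap_apply, groupAlgebraAction_single]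
    rw [nuMap_single, nuMap_single, map_sum, ← hbij.sum_comp]
    refine Finset.sum_congr rfl fun γ _ => ?_
    rw [groupAlgebraAction_single, cosetElt_smul]
    have hψ' : ψ (fun i => σ • cosetElt hS γ g i) = ψ (cosetElt hS γ g) := hψ σ _
    have hp : (List.ofFn fun i => σ • g i).prod = σ • (List.ofFn g).prod :=
      prod_ofFn_map (MulDistribMulAction.toMonoidHom G σ) g
    rw [hψ', hp]
    simp only [smul_mul', smul_inv', hσx]
  exact DFunLike.congr_fun key a

end Cochains

/-! ### Passage to cohomology -/

section InducedMaps

variable {k G Γ : Type*} [Field k] [Group G] [Group Γ] [MulDistribMulAction Γ G] {x : G}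

theorem piMap_mem_groupCocycles {n : ℕ}
    {φ : HochschildCochain k (MonoidAlgebra k G) (MonoidAlgebra k G) n}
    (hφ : φ ∈ hochschildCocycles (groupAlgebraBimodule k Γ x) n) :
    piMap k x n φ ∈ groupCocycles (centModule k Γ x) n := by
  refine ⟨piMap_mem_groupCochains hφ.1, ?_⟩
  change groupD _ n _ = 0
  rw [groupD_piMap, show hochschildD n φ = 0 from hφ.2, map_zero]

theorem piMap_mem_groupCoboundaries {n : ℕ}
    {φ : HochschildCochain k (MonoidAlgebra k G) (MonoidAlgebra k G) n}
    (hφ : φ ∈ hochschildCoboundaries (groupAlgebraBimodule k Γ x) n) :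
    piMap k x n φ ∈ groupCoboundaries (centModule k Γ x) n := by
  cases n with
  | zero =>
    rw [(Submodule.mem_bot k).mp hφ, map_zero]
    exact Submodule.zero_mem _
  | succ n =>
    obtain ⟨θ, hθ, rfl⟩ := hφ
    exact ⟨piMap k x n θ, piMap_mem_groupCochains hθ, groupD_piMap θ⟩

variable {S : Set G} (hS : Subgroup.IsComplement (Cent x : Set G) S) [Fintype G] [Fintype S]

theorem nuMap_mem_hochschildCocycles
    (hstable : ∀ σ ∈ Stab Γ x, (fun γ : G => σ • γ) '' S = S) {n : ℕ}
    {ψ : (Fin n → Cent x) → k} (hψ : ψ ∈ groupCocycles (centModule k Γ x) n) :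
    nuMap hS k n ψ ∈ hochschildCocycles (groupAlgebraBimodule k Γ x) n := by
  refine ⟨nuMap_mem_hochschildCochains hS hstable hψ.1, ?_⟩
  change hochschildD n _ = 0
  rw [hochschildD_nuMap (Γ := Γ), show groupD _ n ψ = 0 from hψ.2, map_zero]

theorem nuMap_mem_hochschildCoboundaries
    (hstable : ∀ σ ∈ Stab Γ x, (fun γ : G => σ • γ) '' S = S) {n : ℕ}
    {ψ : (Fin n → Cent x) → k} (hψ : ψ ∈ groupCoboundaries (centModule k Γ x) n) :
    nuMap hS k n ψ ∈ hochschildCoboundaries (groupAlgebraBimodule k Γ x) n := by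
  cases n with
  | zero =>
    rw [(Submodule.mem_bot k).mp hψ, map_zero]
    exact Submodule.zero_mem _
  | succ n =>
    obtain ⟨θ, hθ, rfl⟩ := hψ
    exact ⟨nuMap hS k n θ, nuMap_mem_hochschildCochains hS hstable hθ, hochschildD_nuMap hS θ⟩

/-- The map in cohomology induced by `νⁿ`. -/
noncomputable def nuCohomology (hstable : ∀ σ ∈ Stab Γ x, (fun γ : G => σ • γ) '' S = S) (n : ℕ) :
    GroupCohomology (centModule k Γ x) n →ₗ[k]
      HochschildCohomology (groupAlgebraBimodule k Γ x) n :=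
  Submodule.mapQ _ _
    ((nuMap hS k n).restrict fun _ hψ => nuMap_mem_hochschildCocycles hS hstable hψ)
    fun _ hψ => nuMap_mem_hochschildCoboundaries hS hstable hψ

variable (k Γ x) in
/-- The map in cohomology induced by `πⁿ`. -/
noncomputable def piCohomology (n : ℕ) :
    HochschildCohomology (groupAlgebraBimodule k Γ x) n →ₗ[k]
      GroupCohomology (centModule k Γ x) n :=
  Submodule.mapQ _ _ ((piMap k x n).restrict fun _ hφ => piMap_mem_groupCocycles hφ)
    fun _ hφ => piMap_mem_groupCoboundaries hφ

theorem leftInverse_piCohomology_nuCohomology (hone : (1 : G) ∈ S)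
    (hstable : ∀ σ ∈ Stab Γ x, (fun γ : G => σ • γ) '' S = S) (n : ℕ) :
    Function.LeftInverse (piCohomology k Γ x n) (nuCohomology (k := k) hS hstable n) := by
  intro c
  obtain ⟨ψ, rfl⟩ := Submodule.mkQ_surjective _ c
  -- On the class of a cocycle `ψ`, the composite is by definition the class of `π(ν(ψ))`, so the
  -- cochain identity suffices.
  exact congrArg (groupClass (centModule k Γ x)) (Subtype.ext (piMap_nuMap hS hone ψ.1))

end InducedMaps

end EquivCoh

/-- `S` is the `Γ_x`-stable system `γ_x` of representatives, `G = ⨆_{γ ∈ S} C_G(x) γ`, with `1 ∈ S`. -/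
theorem proposition3p3 {k Γ G : Type*} [Field k] [Group Γ] [Finite Γ] [Group G] [Fintype G]
    [MulDistribMulAction Γ G] (x : G) (S : Set G) [Fintype S]
    (hS : Subgroup.IsComplement (Cent x : Set G) S) (hone : (1 : G) ∈ S)
    (hstable : ∀ σ ∈ Stab Γ x, (fun γ : G => σ • γ) '' S = S) :
    -- `ν` and `π` restrict to maps between the equivariant cochain spaces
    (∀ n, ∀ ψ ∈ groupCochains (centModule k Γ x) n,
      nuMap hS k n ψ ∈ hochschildCochains (groupAlgebraBimodule k Γ x) n) ∧
    (∀ n, ∀ φ ∈ hochschildCochains (groupAlgebraBimodule k Γ x) n,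
      piMap k x n φ ∈ groupCochains (centModule k Γ x) n) ∧
    -- these restrictions commute with the differentials
    (∀ n, ∀ ψ ∈ groupCochains (centModule k Γ x) n,
      hochschildD n (nuMap hS k n ψ) =
        nuMap hS k (n + 1) (groupD (centModule k Γ x) n ψ)) ∧
    (∀ n, ∀ φ ∈ hochschildCochains (groupAlgebraBimodule k Γ x) n,
      groupD (centModule k Γ x) n (piMap k x n φ) =
        piMap k x (n + 1) (hochschildD n φ)) ∧
    -- the induced maps in cohomology
    ∀ n : ℕ, ∃ (νH : GroupCohomology (centModule k Γ x) n →ₗ[k]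
          HochschildCohomology (groupAlgebraBimodule k Γ x) n)
        (πH : HochschildCohomology (groupAlgebraBimodule k Γ x) n →ₗ[k]
          GroupCohomology (centModule k Γ x) n),
      (∀ ψ : groupCocycles (centModule k Γ x) n,
        ∃ h : nuMap hS k n (ψ : (Fin n → Cent x) → k) ∈
            hochschildCocycles (groupAlgebraBimodule k Γ x) n,
          νH (groupClass (centModule k Γ x) ψ) =
            hochschildClass (groupAlgebraBimodule k Γ x) ⟨_, h⟩) ∧
      (∀ φ : hochschildCocycles (groupAlgebraBimodule k Γ x) n,
        ∃ h : piMap k x n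
              (φ : HochschildCochain k (MonoidAlgebra k G) (MonoidAlgebra k G) n) ∈
            groupCocycles (centModule k Γ x) n,
          πH (hochschildClass (groupAlgebraBimodule k Γ x) φ) = groupClass (centModule k Γ x) ⟨_, h⟩) ∧
      Function.Injective νH ∧
      Function.LeftInverse πH νH := by
  refine ⟨fun n ψ hψ => nuMap_mem_hochschildCochains hS hstable hψ,
    fun n φ hφ => piMap_mem_groupCochains hφ, fun n ψ _ => hochschildD_nuMap hS ψ,
    fun n φ _ => groupD_piMap φ, fun n => ?_⟩
  have hinv := leftInverse_piCohomology_nuCohomology (k := k) hS hone hstable n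
  exact ⟨nuCohomology hS hstable n, piCohomology k Γ x n,
    fun ψ => ⟨nuMap_mem_hochschildCocycles hS hstable ψ.2, rfl⟩,
    fun φ => ⟨piMap_mem_groupCocycles φ.2, rfl⟩, hinv.injective, hinv⟩
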